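/- Let $k$ be a field of arbitrary characteristic and let $\Gamma$ be a finite simple graph whose vertex set $V(\Gamma)$ is linearly ordered. Let $$L=L_\Gamma=\langle V(\Gamma)\mid [u,v]=0 \text{ whenever } \{u,v\}\in E(\Gamma)\rangle$$ be the right-angled Artin Lie algebra over $k$, i.e. the quotient of the free Lie $k$-algebra on $V(\Gamma)$ by the ideal generated by these brackets, and let $U(L)$ be its universal enveloping algebra. For $n\ge 0$ let $$P_n=\bigoplus_{w} c_w\,U(L)$$ be the free right $U(L)$-module with one free generator $c_w$ for each (possibly empty) set $w\subseteq V(\Gamma)$ of $n$ vertices that spans a complete subgraph of $\Gamma$. For $n\ge 1$ let $\partial_n\colon P_n\to P_{n-1}$ be the homomorphism of right $U(L)$-modules given on $w=\{v_1<\dots<v_n\}$ by $$\partial_n(c_w)=\sum_{r=1}^{n}(-1)^{r-1}\,c_{w\setminus\{v_r\}}\,v_r,$$ and let $\partial_0\colon P_0=c_\emptyset U(L)\to k$ be the homomorphism $c_\emptyset u\mapsto\varepsilon(u)$, where $\varepsilon\colon U(L)\to k$ is the augmentation (the algebra homomorphism vanishing on $L$) and $k$ is the trivial right $U(L)$-module,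 on which $u\in U(L)$ acts as multiplication by $\varepsilon(u)$. Then $$\mathcal P_\Gamma:\quad \cdots\xrightarrow{\partial_{n+1}}P_n\xrightarrow{\partial_n}P_{n-1}\to\cdots\xrightarrow{\partial_1}P_0\xrightarrow{\partial_0}k\to 0$$ is a free resolution of the trivial right $U(L)$-module $k$: every $P_n$ is free, with basis the elements $c_w$, and the sequence is exact (in particular a complex). -/

import Mathlib

noncomputable section

namespace RAALie

open MulOpposite

/-! ### Right modules

A right module over a ring `R` is, as usual in Mathlib, a module over the opposite ring `Rᵐᵒᵖ`:
`op r • m` is `m r`. In particular `op r • s = s * r` for `s : R`. -/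

/-- The homomorphism of right `R`-modules `R → M`, `r ↦ m r`. -/
def mulRight (R : Type*) [Ring R] {M : Type*} [AddCommGroup M] [Module Rᵐᵒᵖ M] (m : M) :
    R →ₗ[Rᵐᵒᵖ] M where
  toFun r := op r • m
  map_add' r s := by rw [op_add, add_smul]
  map_smul' a r := by
    induction a using MulOpposite.rec' with
    | h a => rw [op_smul_eq_mul, op_mul, mul_smul, RingHom.id_apply]

/-- The augmented sequence `⋯ → P 2 → P 1 → P 0 → M → 0` of `S`-modules is a free resolution
of `M`: all `P n` are free, and the sequence is exact everywhere (in particular all composites of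
consecutive maps vanish). -/
structure IsFreeResolution (S : Type*) [Ring S] {P : ℕ → Type*} [∀ n, AddCommGroup (P n)]
    [∀ n, Module S (P n)] {M : Type*} [AddCommGroup M] [Module S M]
    (d : ∀ n, P (n + 1) →ₗ[S] P n) (ε : P 0 →ₗ[S] M) : Prop where
  free : ∀ n, Module.Free S (P n)
  exact : ∀ n, Function.Exact (d (n + 1)) (d n)
  exact_zero : Function.Exact (d 0) ε
  surjective : Function.Surjective ε

/-! ### The augmentation and the trivial module -/

section Augmentation

variable (k : Type*) [Field k] (L : Type*) [LieRing L] [LieAlgebra k L]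

/-- The augmentation `U(L) → k`: the algebra homomorphism that vanishes on `L`. -/
def augmentation : UniversalEnvelopingAlgebra k L →ₐ[k] k :=
  UniversalEnvelopingAlgebra.lift k 0

/-- The underlying space `k` of the trivial right `U(L)`-module. -/
@[nolint unusedArguments]
def Trivial (k : Type*) [Field k] (L : Type*) [LieRing L] [LieAlgebra k L] : Type _ := k

instance : AddCommGroup (Trivial k L) := inferInstanceAs (AddCommGroup k)

/-- The trivial right `U(L)`-module structure: `u` acts as multiplication by its augmentation. -/
instance : Module (UniversalEnvelopingAlgebra k L)ᵐᵒᵖ (Trivial k L) :=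
  Module.compHom k
    ((augmentation k L).toRingHom.fromOpposite fun _ _ => Commute.all _ _)

/-- The unit of `k`, as an element of the trivial module. -/
def Trivial.one : Trivial k L := (1 : k)

end Augmentation

/-! ### Right-angled Artin Lie algebras -/

section Artin

variable (k : Type*) [Field k] {V : Type*} (Γ : SimpleGraph V)

/-- The relators `[u, v]`, for the edges `{u, v}` of `Γ`. -/
def relators : Set (FreeLieAlgebra k V) :=
  {x | ∃ u v : V, Γ.Adj u v ∧ x = ⁅FreeLieAlgebra.of k u, FreeLieAlgebra.of k v⁆}

/-- The ideal of the free Lie algebra on the vertices that is generated by the relators. -/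
def relatorIdeal : LieIdeal k (FreeLieAlgebra k V) :=
  LieSubmodule.lieSpan k (FreeLieAlgebra k V) (relators k Γ)

/-- The right-angled Artin Lie algebra `⟨V ∣ [u, v] = 0 for all edges {u, v}⟩`. -/
abbrev ArtinLie : Type _ := FreeLieAlgebra k V ⧸ relatorIdeal k Γ

/-- The universal enveloping algebra of the right-angled Artin Lie algebra. -/
abbrev ArtinU : Type _ := UniversalEnvelopingAlgebra k (ArtinLie k Γ)

/-- The vertex `v` as an element of the right-angled Artin Lie algebra. -/
def vertexLie (v : V) : ArtinLie k Γ :=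
  LieSubmodule.Quotient.mk (FreeLieAlgebra.of k v)

/-- The vertex `v` as an element of the enveloping algebra. -/
def vertex (v : V) : ArtinU k Γ :=
  UniversalEnvelopingAlgebra.ι k (vertexLie k Γ v)

/-- The `n`-element (for `n = 0`: empty) sets of vertices that span a complete subgraph. -/
abbrev Clique (n : ℕ) : Type _ := {w : Finset V // Γ.IsNClique n w}

/-- `P_n`: the free right `U(L)`-module on the generators `c_w`, for the `n`-cliques `w`. -/
abbrev P (n : ℕ) : Type _ := Clique Γ n →₀ ArtinU k Γ

/-- The generator `c_w` of `P_n`. -/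
def c {n : ℕ} (w : Clique Γ n) : P k Γ n := Finsupp.single w 1

end Artin

section Complex

variable (k : Type*) [Field k] {V : Type*} [LinearOrder V] (Γ : SimpleGraph V)

/-- The clique `w \ {v}`. -/
def face {Γ : SimpleGraph V} {n : ℕ} (w : Clique Γ (n + 1)) (v : {v // v ∈ w.1}) : Clique Γ n :=
  ⟨w.1.erase v.1, by simpa using w.2.erase_of_mem v.2⟩

/-- The element `∑_r (-1)^{r-1} c_{w \ {v_r}} v_r` of `P_n`, where `v_1 < ⋯ < v_{n+1}` are the
elements of `w`. If `v = v_r`, then `r - 1` is the number of elements of `w` below `v`. -/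
def boundary {n : ℕ} (w : Clique Γ (n + 1)) : P k Γ n :=
  ∑ v : {v // v ∈ w.1},
    (-1 : ℤ) ^ (w.1.filter (· < v.1)).card • op (vertex k Γ v.1) • c k Γ (face w v)

/-- The differential `∂_{n+1} : P_{n+1} → P_n`, the homomorphism of right `U(L)`-modules with
`c_w ↦ ∑_r (-1)^{r-1} c_{w \ {v_r}} v_r`. -/
def d (n : ℕ) : P k Γ (n + 1) →ₗ[(ArtinU k Γ)ᵐᵒᵖ] P k Γ n :=
  Finsupp.lsum ℕ fun w => mulRight (ArtinU k Γ) (boundary k Γ w)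

end Complex

section

variable (k : Type*) [Field k] {V : Type*} (Γ : SimpleGraph V)

/-- The map `∂_0 : P_0 = c_∅ U(L) → k`, `c_∅ u ↦ ε(u)`, where `ε` is the augmentation. -/
def d₀ : P k Γ 0 →ₗ[(ArtinU k Γ)ᵐᵒᵖ] Trivial k (ArtinLie k Γ) :=
  Finsupp.lsum ℕ fun _ => mulRight (ArtinU k Γ) (Trivial.one k (ArtinLie k Γ))

end

end RAALie

end

/-! `U(L)` and the algebra of the trace monoid of `Γ` have the same universal property, so traces
form a `k`-basis of `U(L)` and the pairs `(w, m)`, standing for `c_w m`, form a `k`-basis of the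
complex (`traceAlgebraEquiv`, `chainBasis`). The differential moves a vertex from `w` to the front
of `m`.

Exactness comes from one homotopy `h_v` per vertex, which moves `v` from the front of `m` back into
`w` when `v` is outside `w`, adjacent to all of `w`, and divides `m` on the left. By
`traceD_traceInsert_add`, `∂ h_v + h_v ∂` is the projection onto the pairs for which `v` can be
written first in the product `[w] m`. On a cycle this part is therefore a boundary and can be
subtracted. Doing so for each of the finitely many vertices leaves only a multiple of `(∅, 1)`
(`exists_traceD_eq_sub_single`). That multiple is zero in positive degree; in degree zero its
coefficient is the augmentation. -/

noncomputable section

namespace RAALie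

open MulOpposite

/-! ### The trace monoid of a graph -/

section TraceMonoid

variable {V : Type*} (Γ : SimpleGraph V)

/-- The commutation relations `u v = v u`, for the edges `{u, v}` of `Γ`. -/
def commRel (x y : FreeMonoid V) : Prop :=
  ∃ u v : V, Γ.Adj u v ∧ x = .of u * .of v ∧ y = .of v * .of u

/-- The trace monoid (partially commutative monoid) of `Γ`. -/
abbrev TraceMonoid : Type _ := PresentedMonoid (commRel Γ)

namespace TraceMonoid

/-- The generator of the trace monoid given by a vertex. -/
def gen (v : V) : TraceMonoid Γ := PresentedMonoid.of _ v

variable {Γ}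

theorem gen_mul_gen_of_adj {u v : V} (h : Γ.Adj u v) : gen Γ u * gen Γ v = gen Γ v * gen Γ u :=
  PresentedMonoid.mk_eq_mk_of_rel ⟨u, v, h, rfl, rfl⟩

theorem gen_mul_induction {p : TraceMonoid Γ → Prop} (one : p 1)
    (gen_mul : ∀ v m, p m → p (gen Γ v * m)) (m : TraceMonoid Γ) : p m := by
  obtain ⟨l, rfl⟩ := PresentedMonoid.surjective_mk m
  induction l using FreeMonoid.inductionOn' with
  | one => exact one
  | of_mul v l ih => rw [map_mul]; exact gen_mul v _ ih

variable [DecidableEq V] [DecidableRel Γ.Adj]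

/-- Left multiplication by the vertex `u`, together with its effect on the left quotients by the
vertex `v`. -/
def quotientStep (v u : V) (p : TraceMonoid Γ × Option (TraceMonoid Γ)) :
    TraceMonoid Γ × Option (TraceMonoid Γ) :=
  (gen Γ u * p.1,
    if u = v then some p.1 else if Γ.Adj u v then p.2.map (gen Γ u * ·) else none)

/-- This is what makes left quotients independent of the word chosen for a trace. The trace itself
is carried along because prepending `v` makes it the new quotient. -/
theorem quotientStep_comm {a b : V} (hab : Γ.Adj a b) (v : V)
    (p : TraceMonoid Γ × Option (TraceMonoid Γ)) :
    quotientStep v a (quotientStep v b p) = quotientStep v b (quotientStep v a p) := by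
  have hne := hab.ne
  have h : ∀ x, gen Γ a * (gen Γ b * x) = gen Γ b * (gen Γ a * x) := fun x => by
    rw [← mul_assoc, gen_mul_gen_of_adj hab, mul_assoc]
  simp only [quotientStep, h]
  congr 1
  by_cases ha : a = v
  · subst ha
    simp [hne.symm, hab.symm]
  · by_cases hb : b = v
    · subst hb
      simp [hne, hab]
    · by_cases h1 : Γ.Adj a v <;> by_cases h2 : Γ.Adj b v <;>
        simp [ha, hb, h1, h2, Function.comp_def, h]

/-- The action of the trace monoid that keeps track of left quotients by the vertex `v`. -/
def quotientAction (v : V) :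
    TraceMonoid Γ →* Function.End (TraceMonoid Γ × Option (TraceMonoid Γ)) :=
  PresentedMonoid.lift (M := Function.End (TraceMonoid Γ × Option (TraceMonoid Γ)))
    (quotientStep v) <| by
    rintro _ _ ⟨a, b, hab, rfl, rfl⟩
    rw [map_mul, map_mul]
    exact funext (quotientStep_comm hab v)

/-- The left quotient of `m` by the vertex `v`, if `v` divides `m` on the left. -/
def leftQuotient (v : V) (m : TraceMonoid Γ) : Option (TraceMonoid Γ) :=
  (quotientAction v m (1, none)).2

theorem quotientAction_gen_mul (v u : V) (m : TraceMonoid Γ)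
    (p : TraceMonoid Γ × Option (TraceMonoid Γ)) :
    quotientAction v (gen Γ u * m) p = quotientStep v u (quotientAction v m p) := by
  rw [map_mul]; rfl

theorem quotientAction_fst (v : V) (m : TraceMonoid Γ) : (quotientAction v m (1, none)).1 = m := by
  induction m using gen_mul_induction with
  | one => rfl
  | gen_mul u m ih =>
    rw [quotientAction_gen_mul]
    exact congrArg (gen Γ u * ·) ih

theorem leftQuotient_one (v : V) : leftQuotient v (1 : TraceMonoid Γ) = none := by
  rw [leftQuotient, map_one]; rfl

theorem leftQuotient_gen_mul (v u : V) (m : TraceMonoid Γ) :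
    leftQuotient v (gen Γ u * m) = if u = v then some m else
      if Γ.Adj u v then (leftQuotient v m).map (gen Γ u * ·) else none := by
  rw [leftQuotient, quotientAction_gen_mul, quotientStep, quotientAction_fst, leftQuotient]

theorem leftQuotient_gen_mul_self (v : V) (m : TraceMonoid Γ) :
    leftQuotient v (gen Γ v * m) = some m := by simp [leftQuotient_gen_mul]

/-- Together with `leftQuotient_gen_mul_self`, this identifies `leftQuotient v` as the partial
inverse of left multiplication by `v`. -/
theorem gen_mul_of_leftQuotient_eq {v : V} {m m' : TraceMonoid Γ}
    (h : leftQuotient v m = some m') : gen Γ v * m' = m := by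
  induction m using gen_mul_induction generalizing m' with
  | one => simp [leftQuotient_one] at h
  | gen_mul u m ih =>
    rw [leftQuotient_gen_mul] at h
    split_ifs at h with h1 h2
    · subst h1; simp_all
    · obtain ⟨x, hx, rfl⟩ := Option.map_eq_some_iff.1 h
      rw [← ih hx, ← mul_assoc, ← gen_mul_gen_of_adj h2, mul_assoc]

end TraceMonoid

end TraceMonoid

/-! ### The enveloping algebra is the algebra of the trace monoid -/

section Iso

attribute [local instance] LieRing.ofAssociativeRing LieAlgebra.ofAssociativeAlgebra

variable (k : Type*) [Field k] {V : Type*} (Γ : SimpleGraph V)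

variable {k Γ} in
theorem vertex_mul_vertex_of_adj {u v : V} (h : Γ.Adj u v) :
    vertex k Γ u * vertex k Γ v = vertex k Γ v * vertex k Γ u := by
  have h0 : ⁅vertexLie k Γ u, vertexLie k Γ v⁆ = 0 := by
    rw [vertexLie, vertexLie, ← LieSubmodule.Quotient.mk_bracket]
    exact LieSubmodule.Quotient.mk_eq_zero'.2 (LieSubmodule.subset_lieSpan ⟨u, v, h, rfl⟩)
  have h1 := congrArg (UniversalEnvelopingAlgebra.ι k) h0
  rw [LieHom.map_lie, map_zero, LieRing.of_associative_ring_bracket] at h1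
  exact sub_eq_zero.1 h1

/-- The universal property of the right-angled Artin Lie algebra. -/
def artinLieLift {A : Type*} [Ring A] [Algebra k A] (f : V → A)
    (hf : ∀ u v, Γ.Adj u v → f u * f v = f v * f u) : ArtinLie k Γ →ₗ⁅k⁆ A :=
  let F : FreeLieAlgebra k V →ₗ⁅k⁆ A := FreeLieAlgebra.lift k f
  have hF : relatorIdeal k Γ ≤ F.ker := by
    refine LieSubmodule.lieSpan_le.2 ?_
    rintro _ ⟨u, v, h, rfl⟩
    simp [F, FreeLieAlgebra.lift_of_apply, LieRing.of_associative_ring_bracket, hf u v h]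
  { Submodule.liftQ (relatorIdeal k Γ).toSubmodule (F : FreeLieAlgebra k V →ₗ[k] A)
      (fun x hx => LieHom.mem_ker.1 (hF hx)) with
    map_lie' := by
      rintro ⟨x⟩ ⟨y⟩
      exact F.map_lie x y }

theorem artinLieLift_vertexLie {A : Type*} [Ring A] [Algebra k A] (f : V → A)
    (hf : ∀ u v, Γ.Adj u v → f u * f v = f v * f u) (v : V) :
    artinLieLift k Γ f hf (vertexLie k Γ v) = f v :=
  FreeLieAlgebra.lift_of_apply (R := k) f v

/-- The homomorphism from the enveloping algebra to the algebra of the trace monoid. -/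
def toTraceAlgebra : ArtinU k Γ →ₐ[k] MonoidAlgebra k (TraceMonoid Γ) :=
  UniversalEnvelopingAlgebra.lift k <|
    artinLieLift k Γ (fun v => MonoidAlgebra.of k _ (TraceMonoid.gen Γ v)) fun u v h => by
      rw [← map_mul, ← map_mul, TraceMonoid.gen_mul_gen_of_adj h]

theorem toTraceAlgebra_vertex (v : V) :
    toTraceAlgebra k Γ (vertex k Γ v) = MonoidAlgebra.of k _ (TraceMonoid.gen Γ v) := by
  rw [toTraceAlgebra, vertex, UniversalEnvelopingAlgebra.lift_ι_apply, artinLieLift_vertexLie]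

/-- The product of vertices in the enveloping algebra given by an element of the trace monoid. -/
def monomial : TraceMonoid Γ →* ArtinU k Γ :=
  PresentedMonoid.lift (vertex k Γ) <| by
    rintro _ _ ⟨u, v, h, rfl, rfl⟩
    simpa using vertex_mul_vertex_of_adj h

theorem monomial_gen (v : V) : monomial k Γ (TraceMonoid.gen Γ v) = vertex k Γ v := rfl

theorem toTraceAlgebra_monomial (m : TraceMonoid Γ) :
    toTraceAlgebra k Γ (monomial k Γ m) = MonoidAlgebra.of k _ m := by
  induction m using TraceMonoid.gen_mul_induction with
  | one => simp only [map_one]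
  | gen_mul v m ih => rw [map_mul, map_mul, ih, monomial_gen, toTraceAlgebra_vertex, map_mul]

variable {k Γ} in
theorem artinU_algHom_ext {A : Type*} [Ring A] [Algebra k A] {f g : ArtinU k Γ →ₐ[k] A}
    (h : ∀ v, f (vertex k Γ v) = g (vertex k Γ v)) : f = g := by
  refine UniversalEnvelopingAlgebra.hom_ext k (LieHom.ext fun x => ?_)
  obtain ⟨x, rfl⟩ := LieSubmodule.Quotient.surjective_mk' _ x
  let q : FreeLieAlgebra k V →ₗ⁅k⁆ ArtinLie k Γ :=
    { LieSubmodule.Quotient.mk' (relatorIdeal k Γ) with map_lie' := rfl }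
  have : (((f : ArtinU k Γ →ₗ⁅k⁆ A).comp (UniversalEnvelopingAlgebra.ι k)).comp q) =
      (((g : ArtinU k Γ →ₗ⁅k⁆ A).comp (UniversalEnvelopingAlgebra.ι k)).comp q) :=
    FreeLieAlgebra.hom_ext h
  exact LieHom.congr_fun this x

/-- The enveloping algebra is the algebra of the trace monoid. -/
def traceAlgebraEquiv : ArtinU k Γ ≃ₐ[k] MonoidAlgebra k (TraceMonoid Γ) :=
  AlgEquiv.ofAlgHom (toTraceAlgebra k Γ) (MonoidAlgebra.lift k _ _ (monomial k Γ))
    (MonoidAlgebra.algHom_ext (fun m => by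
      simpa using toTraceAlgebra_monomial k Γ m) (Subsingleton.elim _ _))
    (artinU_algHom_ext fun v => by
      simp [toTraceAlgebra_vertex, monomial_gen])

/-- The basis of the enveloping algebra that consists of the products of vertices. -/
def monomialBasis : Module.Basis (TraceMonoid Γ) k (ArtinU k Γ) :=
  (MonoidAlgebra.basis (TraceMonoid Γ) k).map (traceAlgebraEquiv k Γ).symm.toLinearEquiv

theorem monomialBasis_apply (m : TraceMonoid Γ) : monomialBasis k Γ m = monomial k Γ m := by
  simp [monomialBasis, traceAlgebraEquiv]

theorem augmentation_vertex (v : V) : augmentation k (ArtinLie k Γ) (vertex k Γ v) = 0 := by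
  rw [augmentation, vertex, UniversalEnvelopingAlgebra.lift_ι_apply, LieHom.zero_apply]

end Iso

/-! ### The complex on the products of sets of vertices and traces -/

section TraceComplex

variable {V : Type*} [LinearOrder V]

/-- The sign `(-1)^{r-1}` of the vertex `v = v_r` of `w`. -/
def sign (w : Finset V) (v : V) : ℤ := (-1) ^ (w.filter (· < v)).card

theorem sign_mul_self (w : Finset V) (v : V) : sign w v * sign w v = 1 := by
  rw [sign, ← mul_pow]; simp

theorem sign_insert {w : Finset V} {v : V} (hv : v ∉ w) (u : V) :
    sign (insert v w) u = if v < u then -sign w u else sign w u := by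
  unfold sign
  rw [Finset.filter_insert]
  split_ifs
  · rw [Finset.card_insert_of_notMem (by simp [hv]), pow_succ]; ring
  · rfl

theorem sign_erase {w : Finset V} {v : V} (hv : v ∈ w) (u : V) :
    sign (w.erase v) u = if v < u then -sign w u else sign w u := by
  have h := sign_insert (Finset.notMem_erase v w) u
  rw [Finset.insert_erase hv] at h
  split_ifs at h ⊢ <;> simp [h]

/-- The cancellation behind `∂ ∂ = 0`: exactly one of the two erasures shifts the position of the
other vertex. -/
theorem sign_erase_mul {w : Finset V} {u v : V} (hu : u ∈ w) (hv : v ∈ w) (h : u ≠ v) :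
    sign w u * sign (w.erase u) v = -(sign w v * sign (w.erase v) u) := by
  rw [sign_erase hu, sign_erase hv]
  rcases h.lt_or_gt with h | h <;> simp [h, h.not_gt, mul_comm]

/-- The cancellation of the mixed terms in `∂ h_v + h_v ∂`. -/
theorem sign_insert_mul {w : Finset V} {u v : V} (hu : u ∈ w) (hv : v ∉ w) :
    sign w v * sign (insert v w) u = -(sign w u * sign (w.erase u) v) := by
  have h : u ≠ v := fun h => hv (h ▸ hu)
  rw [sign_erase hu, sign_insert hv]
  rcases h.lt_or_gt with h | h <;> simp [h, h.not_gt, mul_comm]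

variable (k : Type*) [Field k] (Γ : SimpleGraph V)

/-- The space with basis the pairs `(w, m)`, which stand for `c_w m`. -/
abbrev TraceChains : Type _ := (Finset V × TraceMonoid Γ) →₀ k

/-- The differential of the basis element `(w, m)`. -/
def traceBoundary (p : Finset V × TraceMonoid Γ) : TraceChains k Γ :=
  ∑ u ∈ p.1, sign p.1 u • Finsupp.single (p.1.erase u, TraceMonoid.gen Γ u * p.2) 1

/-- The differential on all pairs. -/
def traceD : TraceChains k Γ →ₗ[k] TraceChains k Γ :=
  Finsupp.linearCombination k (traceBoundary k Γ)

variable {Γ}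

theorem traceD_single (p : Finset V × TraceMonoid Γ) :
    traceD k Γ (Finsupp.single p 1) = traceBoundary k Γ p := by
  simp [traceD]

/-- Removing `u` and `v` in either order gives opposite signs. The traces agree because `u` and `v`
commute, which is where the clique condition enters. -/
theorem traceD_traceBoundary (w : Finset V) (hw : Γ.IsClique w) (m : TraceMonoid Γ) :
    traceD k Γ (traceBoundary k Γ (w, m)) = 0 := by
  simp only [traceBoundary, map_sum, map_zsmul, traceD_single, Finset.smul_sum, smul_smul]
  rw [Finset.sum_sigma']
  refine Finset.sum_involution (fun x _ => ⟨x.2, x.1⟩) ?_ ?_ ?_ ?_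
  · rintro ⟨u, v⟩ h
    simp only [Finset.mem_sigma, Finset.mem_erase] at h
    obtain ⟨hu, hvu, hv⟩ := h
    rw [sign_erase_mul hu hv hvu.symm, Finset.erase_right_comm, ← mul_assoc, ← mul_assoc,
      TraceMonoid.gen_mul_gen_of_adj (hw hu hv hvu.symm), neg_smul, neg_add_cancel]
  · rintro ⟨u, v⟩ h _ h'
    simp only [Finset.mem_sigma, Finset.mem_erase] at h
    exact h.2.1 (congrArg Sigma.fst h')
  · rintro ⟨u, v⟩ h
    simp only [Finset.mem_sigma, Finset.mem_erase] at h ⊢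
    exact ⟨h.2.2, h.2.1.symm, h.1⟩
  · rintro ⟨u, v⟩ h
    rfl

/-- The chains of degree `n`: those supported on the pairs `(w, m)` with `w` an `n`-clique. -/
def cliqueChains (k : Type*) [Field k] (Γ : SimpleGraph V) (n : ℕ) :
    Submodule k (TraceChains k Γ) :=
  Finsupp.supported k k {p | Γ.IsNClique n p.1}

theorem traceD_traceD {n : ℕ} {z : TraceChains k Γ} (hz : z ∈ cliqueChains k Γ n) :
    traceD k Γ (traceD k Γ z) = 0 := by
  conv_lhs => rw [← z.sum_single]
  simp only [Finsupp.sum, map_sum]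
  refine Finset.sum_eq_zero fun p hp => ?_
  rw [← mul_one (z p), ← smul_eq_mul, ← Finsupp.smul_single, map_smul, map_smul, traceD_single,
    traceD_traceBoundary k p.1 (hz hp).isClique, smul_zero]

/-! ### Homotopies indexed by the vertices. -/

variable [DecidableRel Γ.Adj]

/-- The vertex `v` divides the trace `[w] m` on the left. -/
def IsFirst (v : V) (p : Finset V × TraceMonoid Γ) : Prop :=
  v ∈ p.1 ∨ (∀ u ∈ p.1, Γ.Adj u v) ∧ (TraceMonoid.leftQuotient v p.2).isSome

/-- The homotopy that moves the vertex `v` from `m` to `w`, on the basis element `(w, m)`. -/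
def traceInsert (v : V) (p : Finset V × TraceMonoid Γ) : TraceChains k Γ :=
  if v ∉ p.1 ∧ ∀ u ∈ p.1, Γ.Adj u v then
    (TraceMonoid.leftQuotient v p.2).elim 0 fun m =>
      sign p.1 v • Finsupp.single (insert v p.1, m) 1
  else 0

/-- The homotopy that moves the vertex `v` from `m` to `w`. -/
def traceH (v : V) : TraceChains k Γ →ₗ[k] TraceChains k Γ :=
  Finsupp.linearCombination k (traceInsert k v)

theorem traceH_single (v : V) (p : Finset V × TraceMonoid Γ) :
    traceH k v (Finsupp.single p 1) = traceInsert k v p := by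
  simp [traceH]

open Classical in
theorem traceD_traceInsert_add (v : V) (w : Finset V) (hw : Γ.IsClique w) (m : TraceMonoid Γ) :
    traceD k Γ (traceInsert k v (w, m)) + traceH k v (traceBoundary k Γ (w, m)) =
      if IsFirst v (w, m) then Finsupp.single (w, m) 1 else 0 := by
  have hH : traceH k v (traceBoundary k Γ (w, m)) =
      ∑ u ∈ w, sign w u • traceInsert k v (w.erase u, TraceMonoid.gen Γ u * m) := by
    simp only [traceBoundary, map_sum, map_zsmul, traceH_single]
  rw [hH]
  by_cases hv : v ∈ w
  -- Only the face without `v` contributes: the others still contain `v` and are killed by the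
  -- homotopy.
  · rw [if_pos (show IsFirst v (w, m) from Or.inl hv), Finset.sum_eq_single_of_mem v hv, traceInsert, if_neg (by simp [hv]),
      map_zero, zero_add, traceInsert, if_pos, TraceMonoid.leftQuotient_gen_mul_self]
    · have : sign (w.erase v) v = sign w v := by simp [sign_erase hv]
      simp only [Option.elim_some, smul_smul, this, sign_mul_self, Finset.insert_erase hv, one_smul]
    · refine ⟨Finset.notMem_erase v w, fun u hu => ?_⟩
      have := Finset.mem_erase.1 hu
      exact hw this.2 hv this.1
    · intro u _ hu
      rw [traceInsert, if_neg (by simp [hv, hu.symm]), smul_zero]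
  by_cases ha : ∀ u ∈ w, Γ.Adj u v
  · have hins : ∀ u ∈ w, traceInsert k v (w.erase u, TraceMonoid.gen Γ u * m) =
        (TraceMonoid.leftQuotient v m).elim 0 fun m' =>
          sign (w.erase u) v •
            Finsupp.single (insert v (w.erase u), TraceMonoid.gen Γ u * m') 1 := by
      intro u hu
      rw [traceInsert, if_pos ⟨fun h => hv (Finset.mem_of_mem_erase h),
        fun x hx => ha x (Finset.mem_of_mem_erase hx)⟩, TraceMonoid.leftQuotient_gen_mul,
        if_neg (ha u hu).ne, if_pos (ha u hu)]
      cases TraceMonoid.leftQuotient v m <;> rfl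
    rw [Finset.sum_congr rfl fun u hu => by rw [hins u hu], traceInsert, if_pos ⟨hv, ha⟩]
    cases hq : TraceMonoid.leftQuotient v m with
    | none => simp [IsFirst, hv, hq]
    | some m' =>
      -- In the boundary of `(insert v w, m')`, removing `v` restores `(w, m)`; the other terms
      -- cancel against the homotopy of the faces.
      rw [if_pos (show IsFirst v (w, m) from Or.inr ⟨ha, by simp [hq]⟩)]
      simp only [Option.elim_some, map_zsmul, traceD_single, traceBoundary,
        Finset.sum_insert hv, Finset.erase_insert hv, smul_add, smul_smul, Finset.smul_sum]
      rw [TraceMonoid.gen_mul_of_leftQuotient_eq hq, sign_insert hv, if_neg (lt_irrefl v),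
        sign_mul_self, one_smul, add_assoc, ← Finset.sum_add_distrib, Finset.sum_eq_zero, add_zero]
      intro u hu
      rw [sign_insert_mul hu hv, Finset.erase_insert_of_ne (by rintro rfl; exact hv hu), neg_smul,
        neg_add_cancel]
  · rw [if_neg (by simp [IsFirst, hv, ha]), traceInsert, if_neg (by tauto), map_zero, zero_add]
    refine Finset.sum_eq_zero fun u hu => ?_
    rw [traceInsert]
    split_ifs with h
    -- If `v` is adjacent to all of `w` except `u`, the face without `u` puts `u` in front of `m`,
    -- where it blocks `v`.
    · have hu' : ¬ Γ.Adj u v := fun h' => ha fun x hx => by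
        by_cases hxu : x = u
        · exact hxu ▸ h'
        · exact h.2 x (Finset.mem_erase.2 ⟨hxu, hx⟩)
      rw [TraceMonoid.leftQuotient_gen_mul, if_neg (by rintro rfl; exact hv hu), if_neg hu']
      exact smul_zero _
    · exact smul_zero _

theorem eq_one_of_forall_not_isFirst {p : Finset V × TraceMonoid Γ} (h : ∀ v, ¬ IsFirst v p) :
    p = (∅, 1) := by
  obtain ⟨w, m⟩ := p
  have hw : w = ∅ := Finset.eq_empty_of_forall_notMem fun v hv => h v (Or.inl hv)
  subst hw
  induction m using TraceMonoid.gen_mul_induction with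
  | one => rfl
  | gen_mul v m =>
    exact absurd (Or.inr ⟨by simp, by simp [TraceMonoid.leftQuotient_gen_mul_self]⟩) (h v)

theorem traceH_mem (v : V) {n : ℕ} {z : TraceChains k Γ} (hz : z ∈ cliqueChains k Γ n) :
    traceH k v z ∈ cliqueChains k Γ (n + 1) := by
  rw [traceH, Finsupp.linearCombination_apply]
  refine Submodule.sum_mem _ fun p hp => Submodule.smul_mem _ _ ?_
  have hw : Γ.IsNClique n p.1 := hz hp
  rw [traceInsert]
  split_ifs with h
  · cases TraceMonoid.leftQuotient v p.2 with
    | none => exact zero_mem _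
    | some m =>
      refine zsmul_mem (Finsupp.single_mem_supported k 1 ?_) _
      exact hw.insert fun u hu => (h.2 u hu).symm
  · exact zero_mem _

open Classical in
theorem traceD_traceH_add (v : V) {n : ℕ} {z : TraceChains k Γ} (hz : z ∈ cliqueChains k Γ n) :
    traceD k Γ (traceH k v z) + traceH k v (traceD k Γ z) = z.filter (IsFirst v) := by
  have key : ∀ p ∈ z.support,
      traceD k Γ (traceH k v (Finsupp.single p (z p))) +
        traceH k v (traceD k Γ (Finsupp.single p (z p))) =
        (Finsupp.single p (z p)).filter (IsFirst v) := fun p hp => by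
    rw [← mul_one (z p), ← smul_eq_mul, ← Finsupp.smul_single]
    simp only [map_smul, traceD_single, traceH_single, ← smul_add]
    rw [traceD_traceInsert_add k v p.1 (hz hp).isClique, Finsupp.filter_smul]
    split_ifs with h
    · rw [Finsupp.filter_single_of_pos _ h]
    · rw [Finsupp.filter_single_of_neg _ h]
  conv_lhs => rw [← z.sum_single]
  conv_rhs => rw [← z.sum_single]
  simp only [Finsupp.sum, map_sum, ← Finset.sum_add_distrib]
  rw [Finset.sum_congr rfl key, Finsupp.filter_sum]

open Classical in
theorem exists_traceD_eq_sub_filter {n : ℕ} {z : TraceChains k Γ} (hz : z ∈ cliqueChains k Γ n)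
    (hd : traceD k Γ z = 0) (s : Finset V) :
    ∃ y ∈ cliqueChains k Γ (n + 1),
      traceD k Γ y = z - z.filter (fun p => ∀ v ∈ s, ¬ IsFirst v p) := by
  induction s using Finset.induction_on with
  | empty =>
    refine ⟨0, zero_mem _, ?_⟩
    rw [map_zero, eq_comm, sub_eq_zero]
    ext p
    simp
  | insert v s _ ih =>
    obtain ⟨y, hy, hyz⟩ := ih
    set z' := z.filter (fun p => ∀ v ∈ s, ¬ IsFirst v p) with hz'
    have hzm : z' ∈ cliqueChains k Γ n := fun p hp =>
      hz (Finset.filter_subset _ _ hp)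
    -- The remainder `z'` is `z` minus a boundary, hence again a cycle, so the homotopy for `v`
    -- applies to it.
    have hdz : traceD k Γ z' = 0 := by
      have := congrArg (traceD k Γ) hyz
      rw [traceD_traceD k hy, map_sub, hd, zero_sub] at this
      exact neg_eq_zero.1 this.symm
    have h := traceD_traceH_add k v hzm
    rw [hdz, map_zero, add_zero] at h
    refine ⟨y + traceH k v z', add_mem hy (traceH_mem k v hzm), ?_⟩
    rw [map_add, hyz, h]
    have h' : z.filter (fun p => ∀ u ∈ insert v s, ¬ IsFirst u p) =
        z'.filter (fun p => ¬ IsFirst v p) := by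
      ext p
      by_cases h1 : IsFirst v p <;> simp [hz', Finsupp.filter_apply, h1]
    rw [h', eq_sub_iff_add_eq, add_assoc, Finsupp.filter_add_filter_not, sub_add_cancel]

theorem exists_traceD_eq_sub_single [Finite V] {n : ℕ} {z : TraceChains k Γ}
    (hz : z ∈ cliqueChains k Γ n) (hd : traceD k Γ z = 0) :
    ∃ y ∈ cliqueChains k Γ (n + 1),
      traceD k Γ y = z - Finsupp.single (∅, 1) (z (∅, 1)) := by
  classical
  have := Fintype.ofFinite V
  obtain ⟨y, hy, h⟩ := exists_traceD_eq_sub_filter k hz hd Finset.univ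
  refine ⟨y, hy, h.trans (congrArg (z - ·) ?_)⟩
  ext p
  by_cases hp : p = (∅, 1)
  · subst hp
    simp [IsFirst, TraceMonoid.leftQuotient_one]
  · have : ¬ ∀ v ∈ Finset.univ, ¬ IsFirst v p := fun h =>
      hp (eq_one_of_forall_not_isFirst fun v => h v (Finset.mem_univ v))
    rw [Finsupp.filter_apply, if_neg this, Finsupp.single_eq_of_ne hp]

end TraceComplex

/-! ### The resolution -/

section Basis

variable (k : Type*) [Field k] {V : Type*} (Γ : SimpleGraph V)

/-- The right module `U(L)` is free of rank one. -/
def opEquiv (R : Type*) [Ring R] : R ≃ₗ[Rᵐᵒᵖ] Rᵐᵒᵖ where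
  __ := opAddEquiv
  map_smul' a r := by
    induction a using MulOpposite.rec' with
    | h a => simp

/-- The basis of `P_n` that consists of the elements `c_w`. -/
def cliqueBasis (n : ℕ) : Module.Basis (Clique Γ n) (ArtinU k Γ)ᵐᵒᵖ (P k Γ n) :=
  .ofRepr (Finsupp.mapRange.linearEquiv (opEquiv (ArtinU k Γ)))

theorem coe_cliqueBasis (n : ℕ) : ⇑(cliqueBasis k Γ n) = c k Γ := by
  funext w
  apply (cliqueBasis k Γ n).repr.injective
  rw [Module.Basis.repr_self]
  simp [cliqueBasis, c, opEquiv]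

/-- The basis of `P_n` over `k` that consists of the elements `c_w m`, for `m` a trace. -/
def chainBasis (n : ℕ) : Module.Basis (Clique Γ n × TraceMonoid Γ) k (P k Γ n) :=
  (Finsupp.basis fun _ => monomialBasis k Γ).reindex (Equiv.sigmaEquivProd _ _)

theorem chainBasis_apply {n : ℕ} (w : Clique Γ n) (m : TraceMonoid Γ) :
    chainBasis k Γ n (w, m) = op (monomial k Γ m) • c k Γ w := by
  simp [chainBasis, c, monomialBasis_apply]

/-- The embedding of `P_n` into the space with basis the pairs `(w, m)`. -/
def toTraceChains (n : ℕ) : P k Γ n →ₗ[k] TraceChains k Γ :=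
  Finsupp.lmapDomain k k (Prod.map Subtype.val id) ∘ₗ (chainBasis k Γ n).repr.toLinearMap

theorem toTraceChains_chainBasis {n : ℕ} (p : Clique Γ n × TraceMonoid Γ) :
    toTraceChains k Γ n (chainBasis k Γ n p) = Finsupp.single (p.1.1, p.2) 1 := by
  simp [toTraceChains, Prod.map]

theorem toTraceChains_injective (n : ℕ) : Function.Injective (toTraceChains k Γ n) :=
  (Finsupp.mapDomain_injective (Subtype.val_injective.prodMap Function.injective_id)).comp
    (chainBasis k Γ n).repr.injective

/-- With injectivity, this lets a primitive found among the trace chains be pulled back to `P_n`. -/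
theorem range_toTraceChains (n : ℕ) :
    LinearMap.range (toTraceChains k Γ n) = cliqueChains k Γ n := by
  rw [toTraceChains, LinearMap.range_comp, LinearEquiv.range, ← Finsupp.supported_univ,
    Finsupp.lmapDomain_supported, Set.image_univ, Set.range_prodMap, cliqueChains]
  congr 1
  ext p
  simp

theorem toTraceChains_mem {n : ℕ} (z : P k Γ n) : toTraceChains k Γ n z ∈ cliqueChains k Γ n :=
  range_toTraceChains k Γ n ▸ LinearMap.mem_range_self _ z

theorem d₀_c (w : Clique Γ 0) : d₀ k Γ (c k Γ w) = Trivial.one k (ArtinLie k Γ) := by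
  simp [d₀, c, mulRight]

theorem d₀_smul (a : k) (z : P k Γ 0) :
    d₀ k Γ (a • z) = op (algebraMap k (ArtinU k Γ) a) • d₀ k Γ z := by
  rw [← map_smul]
  congr 1
  ext w
  simp [Algebra.smul_def, Algebra.commutes]

theorem op_algebraMap_smul_one (a : k) :
    op (algebraMap k (ArtinU k Γ) a) • Trivial.one k (ArtinLie k Γ) = (a : k) :=
  (congrArg (· • (1 : k)) ((augmentation k (ArtinLie k Γ)).commutes a)).trans (mul_one a)

variable [LinearOrder V]

theorem d_c {n : ℕ} (w : Clique Γ (n + 1)) : d k Γ n (c k Γ w) = boundary k Γ w := by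
  simp [d, c, mulRight]

theorem toTraceChains_d {n : ℕ} (z : P k Γ (n + 1)) :
    toTraceChains k Γ n (d k Γ n z) = traceD k Γ (toTraceChains k Γ (n + 1) z) := by
  have : toTraceChains k Γ n ∘ₗ (d k Γ n).restrictScalars k =
      traceD k Γ ∘ₗ toTraceChains k Γ (n + 1) := by
    refine (chainBasis k Γ (n + 1)).ext fun ⟨w, m⟩ => ?_
    rw [LinearMap.comp_apply, LinearMap.comp_apply, toTraceChains_chainBasis, traceD_single,
      traceBoundary, LinearMap.restrictScalars_apply, chainBasis_apply, map_smul, d_c, boundary,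
      Finset.smul_sum, map_sum, ← Finset.sum_coe_sort w.1]
    refine Finset.sum_congr rfl fun u _ => ?_
    rw [smul_comm, smul_smul, ← op_mul, ← monomial_gen, ← map_mul, ← chainBasis_apply, map_zsmul,
      toTraceChains_chainBasis]
    rfl
  exact LinearMap.congr_fun this z

theorem d₀_d (z : P k Γ 1) : d₀ k Γ (d k Γ 0 z) = 0 := by
  have : d₀ k Γ ∘ₗ d k Γ 0 = 0 := by
    refine (cliqueBasis k Γ 1).ext fun w => ?_
    rw [coe_cliqueBasis, LinearMap.comp_apply, d_c, boundary, map_sum]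
    refine Finset.sum_eq_zero fun u _ => ?_
    rw [map_zsmul, map_smul, d₀_c]
    -- The action on the trivial module unfolds to multiplication by the augmentation, which kills
    -- vertices.
    have : op (vertex k Γ u.1) • Trivial.one k (ArtinLie k Γ) = 0 :=
      (zero_smul k (1 : k)).symm ▸ congrArg (· • (1 : k)) (augmentation_vertex k Γ u.1)
    rw [this, smul_zero]
  exact LinearMap.congr_fun this z

theorem isFreeResolution [Finite V] :
    IsFreeResolution (ArtinU k Γ)ᵐᵒᵖ (d k Γ) (d₀ k Γ) where
  free n := .of_basis (cliqueBasis k Γ n)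
  exact n z := by
    classical
    constructor
    · intro hz
      have hD : traceD k Γ (toTraceChains k Γ (n + 1) z) = 0 := by
        rw [← toTraceChains_d, hz, map_zero]
      have hm : toTraceChains k Γ (n + 1) z ∈ cliqueChains k Γ (n + 1) :=
        toTraceChains_mem k Γ z
      obtain ⟨y, hy, hyz⟩ := exists_traceD_eq_sub_single k hm hD
      rw [← range_toTraceChains] at hy
      obtain ⟨y, rfl⟩ := hy
      refine ⟨y, toTraceChains_injective k Γ _ ?_⟩
      -- The coefficient at `(∅, 1)` vanishes because `∅` is not an `(n + 1)`-clique.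
      rw [toTraceChains_d, hyz, Finsupp.notMem_support_iff.1 fun h => ?_, Finsupp.single_zero,
        sub_zero]
      have := (hm h : Γ.IsNClique (n + 1) ∅).card_eq
      simp at this
    · rintro ⟨y, rfl⟩
      apply toTraceChains_injective k Γ
      rw [toTraceChains_d, toTraceChains_d, map_zero]
      exact traceD_traceD k (toTraceChains_mem k Γ y)
  exact_zero z := by
    classical
    constructor
    · intro hz
      have hm : toTraceChains k Γ 0 z ∈ cliqueChains k Γ 0 := toTraceChains_mem k Γ z
      -- In degree zero every `w` is empty, so every chain is a cycle for `traceD`.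
      have hD : traceD k Γ (toTraceChains k Γ 0 z) = 0 := by
        rw [traceD, Finsupp.linearCombination_apply]
        refine Finset.sum_eq_zero fun p hp => ?_
        have : p.1 = ∅ := Finset.card_eq_zero.1 (hm hp : Γ.IsNClique 0 p.1).card_eq
        simp [traceBoundary, this]
      obtain ⟨y, hy, hyz⟩ := exists_traceD_eq_sub_single k hm hD
      rw [← range_toTraceChains] at hy
      obtain ⟨y, rfl⟩ := hy
      set a := toTraceChains k Γ 0 z (∅, 1)
      let w : Clique Γ 0 := ⟨∅, by simp⟩
      have h : d k Γ 0 y = z - a • chainBasis k Γ 0 (w, 1) := by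
        apply toTraceChains_injective k Γ
        rw [toTraceChains_d, hyz, map_sub, map_smul, toTraceChains_chainBasis, Finsupp.smul_single,
          smul_eq_mul, mul_one]
      -- Applying `d₀` to `h` kills `d y` and `z` and leaves the coefficient `a`.
      have ha : a = 0 := by
        have := congrArg (d₀ k Γ) h
        rw [d₀_d, map_sub, hz, zero_sub, d₀_smul, chainBasis_apply, map_one, op_one, one_smul,
          d₀_c, op_algebraMap_smul_one] at this
        exact neg_eq_zero.1 this.symm
      exact ⟨y, by rw [h, ha, zero_smul, sub_zero]⟩
    · rintro ⟨y, rfl⟩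
      exact d₀_d k Γ y
  surjective a := by
    let w : Clique Γ 0 := ⟨∅, by simp⟩
    refine ⟨op (algebraMap k (ArtinU k Γ) (show k from a)) • c k Γ w, ?_⟩
    rw [map_smul, d₀_c]
    exact op_algebraMap_smul_one k Γ a

end Basis

end RAALie

end

theorem mainTheorem7 (k : Type*) [Field k] (V : Type*) [Finite V] [LinearOrder V]
    (Γ : SimpleGraph V) :
    (∀ n, LinearIndependent (RAALie.ArtinU k Γ)ᵐᵒᵖ
        (fun w : RAALie.Clique Γ n => RAALie.c k Γ w) ∧
      Submodule.span (RAALie.ArtinU k Γ)ᵐᵒᵖ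
        (Set.range fun w : RAALie.Clique Γ n => RAALie.c k Γ w) = ⊤) ∧
    (∀ n (w : RAALie.Clique Γ (n + 1)),
      RAALie.d k Γ n (RAALie.c k Γ w) =
        ∑ v : {v // v ∈ w.1}, (-1 : ℤ) ^ (w.1.filter (· < v.1)).card •
          MulOpposite.op (RAALie.vertex k Γ v.1) • RAALie.c k Γ (RAALie.face w v)) ∧
    (∀ w : RAALie.Clique Γ 0,
      RAALie.d₀ k Γ (RAALie.c k Γ w) = RAALie.Trivial.one k (RAALie.ArtinLie k Γ)) ∧
    RAALie.IsFreeResolution (RAALie.ArtinU k Γ)ᵐᵒᵖ (RAALie.d k Γ) (RAALie.d₀ k Γ) := by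
  refine ⟨fun n => ?_, fun n w => RAALie.d_c k Γ w, RAALie.d₀_c k Γ, RAALie.isFreeResolution k Γ⟩
  have h := RAALie.coe_cliqueBasis k Γ n
  exact ⟨h ▸ (RAALie.cliqueBasis k Γ n).linearIndependent,
    h ▸ (RAALie.cliqueBasis k Γ n).span_eq⟩
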